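/- Let $\mathbf{H}^3$ be hyperbolic $3$-space, in the upper half space model $\mathbb{C}\times(0,\infty)$, let $\mathbf{I}$ be its full isometry group, and let $\mathbf{S}=\mathbb{C}\cup\{\infty\}$ be its ideal boundary; every element of $\mathbf{I}$ extends continuously to a homeomorphism of $\mathbf{S}$. A *nice lattice* is a subgroup $\Gamma\subset\mathbf{I}$ such that $\mathbf{H}^3\to\mathbf{H}^3/\Gamma$ is a covering map with deck group $\Gamma$ and $\mathbf{H}^3/\Gamma$ is compact. An *equivariant pair* $(H,h)$ consists of a bi-Lipschitz bijection $H:\mathbf{H}^3\to\mathbf{H}^3$ (that is, for some $K\ge 1$, $K^{-1}d(x,y)\le d(H(x),H(y))\le K\,d(x,y)$ for all $x,y$) and a homeomorphism $h:\mathbf{S}\to\mathbf{S}$ which extends $H$ continuously, such that for some nice lattices $\Gamma_1,\Gamma_2$ one has both $H\Gamma_1H^{-1}=\Gamma_2$ on $\mathbf{H}^3$ and $h\Gamma_1h^{-1}=\Gamma_2$ on $\mathbf{S}$. **Theorem.** Let $(H,h)$ be an equivariant pair with $h(\infty)=\infty$, and regard $h$ as a homeomorphism of $\mathbb{C}$.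 Then $h$ has an *asterisk*: there is a point $z\in\mathbb{C}$ such that for every $v\in\mathbb{C}$ with rational real and imaginary parts the directional derivative $$D_vh(z)=\lim_{t\to 0,\ t\in\mathbb{R}}\frac{h(z+vt)-h(z)}{t}$$ exists, and $D_1h(z)\neq 0$. -/

import Mathlib

open Topology Filter

noncomputable section

/-- The upper half space `ℂ × (0, ∞)`. -/
@[ext]
structure H3 where
  z : ℂ
  t : ℝ
  t_pos : 0 < t

namespace H3

/-- The point `(z, t)` of Euclidean `ℂ × ℝ`. -/
def toEuclidean (p : H3) : WithLp 2 (ℂ × ℝ) := WithLp.toLp 2 (p.z, p.t)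

/-- The mirror image `(z, -t)` in Euclidean `ℂ × ℝ`. -/
def mirror (p : H3) : WithLp 2 (ℂ × ℝ) := WithLp.toLp 2 (p.z, -p.t)

/-- The hyperbolic distance of curvature `-1`: `sinh (d/2) = |p - q| / (2 √(t s))`, where `|p - q|`
is the Euclidean distance and `t`, `s` are the heights. -/
instance : Dist H3 :=
  ⟨fun p q => 2 * Real.arsinh (dist p.toEuclidean q.toEuclidean / (2 * √(p.t * q.t)))⟩

theorem dist_eq (p q : H3) :
    dist p q = 2 * Real.arsinh (dist p.toEuclidean q.toEuclidean / (2 * √(p.t * q.t))) := rfl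

theorem euclidean_dist_sq (p q : H3) :
    dist p.toEuclidean q.toEuclidean ^ 2 = ‖p.z - q.z‖ ^ 2 + (p.t - q.t) ^ 2 := by
  rw [WithLp.prod_dist_eq_of_L2, Real.sq_sqrt (by positivity)]
  simp [toEuclidean, Complex.dist_eq, Real.dist_eq]

theorem mirror_dist_sq (p q : H3) :
    dist p.toEuclidean q.mirror ^ 2 = ‖p.z - q.z‖ ^ 2 + (p.t + q.t) ^ 2 := by
  rw [WithLp.prod_dist_eq_of_L2, Real.sq_sqrt (by positivity)]
  simp [toEuclidean, mirror, Complex.dist_eq, Real.dist_eq]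

theorem mirror_dist_comm (p q : H3) :
    dist p.toEuclidean q.mirror = dist q.toEuclidean p.mirror := by
  rw [← sq_eq_sq₀ dist_nonneg dist_nonneg, mirror_dist_sq, mirror_dist_sq, norm_sub_rev, add_comm p.t]

theorem mirror_dist_self (p : H3) : dist p.toEuclidean p.mirror = 2 * p.t := by
  rw [← sq_eq_sq₀ dist_nonneg (by linarith [p.t_pos]), mirror_dist_sq]
  simp
  ring

theorem sinh_half_dist (p q : H3) :
    Real.sinh (dist p q / 2) = dist p.toEuclidean q.toEuclidean / (2 * √(p.t * q.t)) := by
  rw [dist_eq, mul_div_cancel_left₀ _ two_ne_zero, Real.sinh_arsinh]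

theorem cosh_half_dist (p q : H3) :
    Real.cosh (dist p q / 2) = dist p.toEuclidean q.mirror / (2 * √(p.t * q.t)) := by
  have hp := p.t_pos
  have hq := q.t_pos
  have hpq : 0 < p.t * q.t := mul_pos hp hq
  rw [← sq_eq_sq₀ (Real.cosh_pos _).le (by positivity), Real.cosh_sq', sinh_half_dist, div_pow,
    div_pow, mul_pow, Real.sq_sqrt hpq.le, euclidean_dist_sq, mirror_dist_sq]
  field_simp
  ring

protected theorem dist_triangle (a b c : H3) : dist a c ≤ dist a b + dist b c := by
  have ha := a.t_pos
  have hb := b.t_pos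
  have hc := c.t_pos
  have key := EuclideanGeometry.mul_dist_le_mul_dist_add_mul_dist
    a.toEuclidean b.toEuclidean c.toEuclidean b.mirror
  rw [mirror_dist_self] at key
  suffices h : dist a c / 2 ≤ dist a b / 2 + dist b c / 2 by linarith
  rw [← Real.sinh_le_sinh, Real.sinh_add, sinh_half_dist, sinh_half_dist, sinh_half_dist,
    cosh_half_dist, cosh_half_dist, mirror_dist_comm b c, Real.sqrt_mul ha.le, Real.sqrt_mul ha.le,
    Real.sqrt_mul hb.le]
  have sa : 0 < √a.t := Real.sqrt_pos.2 ha
  have sb : 0 < √b.t := Real.sqrt_pos.2 hb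
  have sc : 0 < √c.t := Real.sqrt_pos.2 hc
  have hbb : √b.t * √b.t = b.t := Real.mul_self_sqrt hb.le
  rw [div_mul_div_comm, div_mul_div_comm, ← add_div, div_le_div_iff₀ (by positivity) (by positivity)]
  calc _ = (dist a.toEuclidean c.toEuclidean * (2 * (√b.t * √b.t))) * (2 * (√a.t * √c.t)) := by ring
    _ ≤ (dist a.toEuclidean b.toEuclidean * dist c.toEuclidean b.mirror +
          dist b.toEuclidean c.toEuclidean * dist a.toEuclidean b.mirror) *
            (2 * (√a.t * √c.t)) := by rw [hbb]; gcongr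
    _ = _ := by ring

/-- Hyperbolic 3-space. -/
instance : MetricSpace H3 where
  dist_self p := by simp [dist_eq]
  dist_comm p q := by rw [dist_eq, dist_eq, dist_comm, mul_comm p.t]
  dist_triangle := H3.dist_triangle
  eq_of_dist_eq_zero {p q} h := by
    have hpq : √(p.t * q.t) ≠ 0 := (Real.sqrt_pos.2 (mul_pos p.t_pos q.t_pos)).ne'
    have h0 : dist p.toEuclidean q.toEuclidean = 0 := by
      simpa [dist_eq, hpq] using h
    have h1 : p.toEuclidean = q.toEuclidean := dist_eq_zero.1 h0
    simp only [toEuclidean, WithLp.toLp.injEq, Prod.mk.injEq] at h1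
    exact H3.ext h1.1 h1.2

/-- The group of all isometries acts on hyperbolic 3-space by evaluation. -/
instance : MulAction (H3 ≃ᵢ H3) H3 where
  smul g p := g p
  one_smul _ := rfl
  mul_smul _ _ _ := rfl

end H3

/-- The Riemann sphere `ℂ ∪ {∞}`. -/
abbrev Sphere : Type := OnePoint ℂ

/-- Hyperbolic 3-space together with its ideal boundary. -/
inductive ClosedH3 : Type
  | inner (p : H3) : ClosedH3
  | ideal (x : Sphere) : ClosedH3

namespace ClosedH3

/-- The inclusion into the one-point compactification of `ℂ × ℝ`: an inner point goes to `(z, t)`,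
an ideal point `z` to `(z, 0)` and the ideal point `∞` to `∞`. -/
def toOnePoint : ClosedH3 → OnePoint (ℂ × ℝ)
  | inner p => ((p.z, p.t) : ℂ × ℝ)
  | ideal x => OnePoint.map (fun z : ℂ => ((z, 0) : ℂ × ℝ)) x

/-- The topology of the closed upper half space with `∞` added (a closed ball). -/
instance : TopologicalSpace ClosedH3 :=
  TopologicalSpace.induced toOnePoint inferInstance

/-- The self-map that is `H` inside and `h` on the ideal boundary. -/
def glue (H : H3 → H3) (h : Sphere → Sphere) : ClosedH3 → ClosedH3
  | inner p => inner (H p)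
  | ideal x => ideal (h x)

end ClosedH3

/-- `h` is a continuous extension of `H` to the Riemann sphere. -/
def IsBoundaryExtension (H : H3 → H3) (h : Sphere → Sphere) : Prop :=
  Continuous (ClosedH3.glue H h)

/-- Bi-Lipschitz bijections. -/
def IsBL {X Y : Type*} [MetricSpace X] [MetricSpace Y] (H : X → Y) : Prop :=
  Function.Bijective H ∧ ∃ K : ℝ, 1 ≤ K ∧
    ∀ x y : X, K⁻¹ * dist x y ≤ dist (H x) (H y) ∧ dist (H x) (H y) ≤ K * dist x y

/-- A nice lattice: the projection from hyperbolic 3-space to the orbit space of `Γ` is a covering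
map with deck group `Γ`, and the orbit space is compact. -/
structure IsNiceLattice (Γ : Subgroup (H3 ≃ᵢ H3)) : Prop where
  covering : IsQuotientCoveringMap (Quotient.mk (MulAction.orbitRel Γ H3)) Γ
  compact : CompactSpace (Quotient (MulAction.orbitRel Γ H3))

/-- The homeomorphisms of the sphere by which the elements of `Γ` act on the ideal boundary. -/
def boundaryAction (Γ : Subgroup (H3 ≃ᵢ H3)) : Set (Sphere ≃ₜ Sphere) :=
  {g | ∃ γ ∈ Γ, IsBoundaryExtension γ g}

/-- A bi-Lipschitz `H` and a continuous extension `h` of it to the sphere which are both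
equivariant with respect to the same pair of nice lattices: `H Γ₁ H⁻¹ = Γ₂`, `h Γ₁ h⁻¹ = Γ₂`. -/
structure IsEquivariantPair (H : Equiv.Perm H3) (h : Sphere ≃ₜ Sphere) : Prop where
  bl : IsBL H
  ext : IsBoundaryExtension H h
  equivariant : ∃ Γ₁ Γ₂ : Subgroup (H3 ≃ᵢ H3), IsNiceLattice Γ₁ ∧ IsNiceLattice Γ₂ ∧
    (fun γ : H3 ≃ᵢ H3 => H * γ.toEquiv * H⁻¹) '' (Γ₁ : Set (H3 ≃ᵢ H3)) =
      IsometryEquiv.toEquiv '' (Γ₂ : Set (H3 ≃ᵢ H3)) ∧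
    (fun g : Sphere ≃ₜ Sphere => h * g * h⁻¹) '' boundaryAction Γ₁ = boundaryAction Γ₂

theorem exists_finite_value (h : Sphere ≃ₜ Sphere) (hinf : h OnePoint.infty = OnePoint.infty)
    (z : ℂ) : ∃ w : ℂ, (w : Sphere) = h (z : Sphere) :=
  OnePoint.ne_infty_iff_exists.1 fun hz =>
    OnePoint.coe_ne_infty z (h.injective (hz.trans hinf.symm))

/-- A homeomorphism of the sphere that fixes `∞`, interpreted as a map of `ℂ`. -/
def planeMap (h : Sphere ≃ₜ Sphere) (hinf : h OnePoint.infty = OnePoint.infty) (z : ℂ) : ℂ :=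
  Classical.choose (exists_finite_value h hinf z)

theorem coe_planeMap (h : Sphere ≃ₜ Sphere) (hinf : h OnePoint.infty = OnePoint.infty) (z : ℂ) :
    (planeMap h hinf z : Sphere) = h (z : Sphere) :=
  Classical.choose_spec (exists_finite_value h hinf z)

/-- `z` is an asterisk for `f`: every directional derivative of `f` at `z` in a direction `a + b i`
with `a`, `b` rational exists, and the one in the direction `1` is not zero. -/
def IsAsterisk (f : ℂ → ℂ) (z : ℂ) : Prop :=
  (∀ a b : ℚ, LineDifferentiableAt ℝ f z ⟨(a : ℝ), (b : ℝ)⟩) ∧ lineDeriv ℝ f z 1 ≠ 0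

end

/-!
Let `z`, `w₁`, `w₂` be points of the plane with `|w₁ - z| ≤ |w₂ - z|`. Seen from a suitable point
`o` of hyperbolic space, `z` is far from `w₂` and `w₁` is far from `∞`. An element of the lattice
moves `o` into a compact set and commutes with `H` up to an isometry of the target, so compactness
of the closed ball bounds the cross-ratio of the images of the four points. Therefore
`|h w₁ - h z| ≤ M |h w₂ - h z|`: the map `h` is weakly quasisymmetric.

As in Gehring's theorem, a weakly quasisymmetric `f` satisfies `|f a - f b|² ≤ C area (f B)` for `a`
and `b` in a disc `B`. By Lebesgue differentiation, around almost every horizontal line the image of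
a strip of half-width `r` and fixed length has area `O(r)`, and the Cauchy–Schwarz inequality then
makes `f` absolutely continuous on that line. Thus `D_v f` exists almost everywhere, for `v = 1` and
after rotation for every `v`, while `D_1 f` cannot vanish almost everywhere because `f` would be
constant on a segment.
-/

open MeasureTheory Set

/-- A map is weakly `K`-quasisymmetric if the image of a point in a ball is at most `K` times as far
from the image of the centre as the image of any point outside the open ball. -/
def WeaklyQuasisymmetric {X Y : Type*} [PseudoMetricSpace X] [PseudoMetricSpace Y] (K : ℝ)
    (f : X → Y) : Prop :=
  ∀ c p q, dist p c ≤ dist q c → dist (f p) (f c) ≤ K * dist (f q) (f c)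

namespace WeaklyQuasisymmetric

variable {X Y : Type*} {K : ℝ}

theorem pos [PseudoMetricSpace X] [Nontrivial X] [MetricSpace Y] {f : X → Y}
    (hf : WeaklyQuasisymmetric K f) (hinj : Function.Injective f) : 0 < K := by
  obtain ⟨p, q, hpq⟩ := exists_pair_ne X
  have hd : 0 < dist (f p) (f q) := dist_pos.2 (hinj.ne hpq)
  exact pos_of_mul_pos_left (hd.trans_le (hf q p p le_rfl)) hd.le

variable [PseudoMetricSpace X] [PseudoMetricSpace Y] {f : X → Y}

theorem dist_map_le (hf : WeaklyQuasisymmetric K f) {a b c p : X} (ha : dist a c ≤ dist p c)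
    (hb : dist b c ≤ dist p c) : dist (f a) (f b) ≤ 2 * K * dist (f p) (f c) := by
  linarith [hf c a p ha, hf c b p hb, dist_triangle_right (f a) (f b) (f c)]

theorem ball_subset_image_ball (hf : WeaklyQuasisymmetric K f) (hK : 0 < K)
    (hsurj : Function.Surjective f) (c p : X) :
    Metric.ball (f c) (dist (f p) (f c) / K) ⊆ f '' Metric.ball c (dist p c) := by
  intro y hy
  obtain ⟨x, rfl⟩ := hsurj y
  refine mem_image_of_mem f (Metric.mem_ball.2 ?_)
  contrapose! hy
  rw [Metric.mem_ball, not_lt, div_le_iff₀' hK]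
  exact hf c p x hy

theorem comp_mul_left {f : ℂ → Y} (hf : WeaklyQuasisymmetric K f) (v : ℂ) :
    WeaklyQuasisymmetric K fun z => f (v * z) := by
  intro c p q h
  refine hf _ _ _ ?_
  simp only [dist_eq_norm, ← mul_sub, norm_mul] at h ⊢
  gcongr

end WeaklyQuasisymmetric

/-- The measure `S ↦ area (f S)`. -/
noncomputable def imageArea (f : ℂ ≃ₜ ℂ) : Measure ℂ := volume.map f.symm

theorem imageArea_apply (f : ℂ ≃ₜ ℂ) (s : Set ℂ) : imageArea f s = volume (f '' s) := by
  rw [f.image_eq_preimage_symm]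
  exact f.symm.toMeasurableEquiv.map_apply s

instance (f : ℂ ≃ₜ ℂ) : IsFiniteMeasureOnCompacts (imageArea f) :=
  Measure.IsFiniteMeasureOnCompacts.map volume f.symm

theorem WeaklyQuasisymmetric.dist_sq_le_imageArea_ball {K : ℝ} {f : ℂ ≃ₜ ℂ}
    (hf : WeaklyQuasisymmetric K f) {c a b : ℂ} {r : ℝ} (ha : dist a c ≤ r) (hb : dist b c ≤ r) :
    dist (f a) (f b) ^ 2 ≤ 4 * K ^ 4 / Real.pi * (imageArea f).real (Metric.ball c r) := by
  have hK : 0 < K := hf.pos f.injective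
  have hp : dist (c + r) c = r := by simpa using dist_nonneg.trans ha
  set l := dist (f (c + r)) (f c)
  have hdiam : dist (f a) (f b) ≤ 2 * K * l := hf.dist_map_le (by rwa [hp]) (by rwa [hp])
  have hball : Metric.ball (f c) (l / K) ⊆ f '' Metric.ball c r := by
    simpa only [hp] using hf.ball_subset_image_ball hK f.surjective c (c + r)
  have harea : Real.pi * (l / K) ^ 2 ≤ (imageArea f).real (Metric.ball c r) := by
    have hvol : volume.real (Metric.ball (f c) (l / K)) = Real.pi * (l / K) ^ 2 := by
      have : 0 ≤ l / K := by positivity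
      simp [Measure.real, this, mul_comm]
    rw [← hvol]
    refine ENNReal.toReal_mono Metric.isBounded_ball.measure_lt_top.ne ?_
    rw [imageArea_apply]
    exact measure_mono hball
  calc dist (f a) (f b) ^ 2 ≤ (2 * K * l) ^ 2 := by gcongr
    _ = 4 * K ^ 4 / Real.pi * (Real.pi * (l / K) ^ 2) := by
      field_simp
      ring
    _ ≤ 4 * K ^ 4 / Real.pi * (imageArea f).real (Metric.ball c r) := by gcongr

section ShortScale

variable {E : Type*} [PseudoMetricSpace E] {g : ℝ → E} {C : ℝ}

theorem sum_measureReal_Ioc_of_monotone (ν : Measure ℝ) [IsLocallyFiniteMeasure ν] {u : ℕ → ℝ}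
    (hu : Monotone u) (n : ℕ) :
    ∑ j ∈ Finset.range n, ν.real (Ioc (u j) (u (j + 1))) = ν.real (Ioc (u 0) (u n)) := by
  rw [← hu.biUnion_Ico_Ioc_map_succ 0 n, ← Finset.coe_Ico, ← Finset.range_eq_Ico]
  exact (measureReal_biUnion_finset (hu.pairwise_disjoint_on_Ioc_succ.set_pairwise _)
    (fun _ _ => measurableSet_Ioc) fun _ _ => measure_Ioc_lt_top.ne).symm

theorem dist_sq_le_of_short_scale {ν : Measure ℝ} [IsLocallyFiniteMeasure ν] {r : ℝ} (hr : 0 < r)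
    (hg : ∀ s t, s ≤ t → t - s ≤ r → dist (g s) (g t) ^ 2 ≤ C * ν.real (Ioc s t)) {a b : ℝ}
    (hab : r ≤ b - a) :
    dist (g a) (g b) ^ 2 ≤ 2 * ((b - a) / r) * (C * ν.real (Ioc a b)) := by
  set n := ⌈(b - a) / r⌉₊
  have hn : (b - a) / r ≤ n := Nat.le_ceil _
  have hn1 : 1 ≤ (b - a) / r := (one_le_div hr).2 hab
  have hn2 : (n : ℝ) ≤ 2 * ((b - a) / r) := Nat.ceil_le_two_mul (by linarith)
  have hn0 : (0 : ℝ) < n := by linarith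
  let u : ℕ → ℝ := fun j => a + j * ((b - a) / n)
  have hu : Monotone u := fun i j hij => by
    have : 0 ≤ b - a := by linarith
    simp only [u]
    gcongr
  have hu0 : u 0 = a := by simp [u]
  have hun : u n = b := by simp [u, mul_div_cancel₀ _ hn0.ne']
  have hstep (j : ℕ) :
      dist (g (u j)) (g (u (j + 1))) ^ 2 ≤ C * ν.real (Ioc (u j) (u (j + 1))) := by
    refine hg _ _ (hu j.le_succ) ?_
    have : u (j + 1) - u j = (b - a) / n := by simp only [u]; push_cast; ring
    rwa [this, div_le_comm₀ hn0 hr]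
  have hsum : ∑ j ∈ Finset.range n, dist (g (u j)) (g (u (j + 1))) ^ 2 ≤ C * ν.real (Ioc a b) := by
    rw [← hu0, ← hun, ← sum_measureReal_Ioc_of_monotone ν hu, Finset.mul_sum]
    exact Finset.sum_le_sum fun j _ => hstep j
  calc dist (g a) (g b) ^ 2
      ≤ (∑ j ∈ Finset.range n, dist (g (u j)) (g (u (j + 1)))) ^ 2 := by
        rw [← hun, ← hu0]
        gcongr
        exact dist_le_range_sum_dist (fun j => g (u j)) n
    _ ≤ n * ∑ j ∈ Finset.range n, dist (g (u j)) (g (u (j + 1))) ^ 2 := by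
        simpa using sq_sum_le_card_mul_sum_sq (s := Finset.range n)
          (f := fun j => dist (g (u j)) (g (u (j + 1))))
    _ ≤ 2 * ((b - a) / r) * (C * ν.real (Ioc a b)) := by gcongr

theorem dist_sq_le_mul_uIoc_of_short_scale {ν : Measure ℝ} [IsLocallyFiniteMeasure ν] {r : ℝ}
    (hr : 0 < r) (hg : ∀ s t, s ≤ t → t - s ≤ r → dist (g s) (g t) ^ 2 ≤ C * ν.real (Ioc s t))
    {a b : ℝ} (hab : a ≠ b → r ≤ dist a b) :
    dist (g a) (g b) ^ 2 ≤ dist a b * (2 * C / r * ν.real (uIoc a b)) := by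
  wlog hle : a ≤ b generalizing a b
  · simpa only [dist_comm, uIoc_comm] using
      this (fun h => (hab h.symm).trans_eq (dist_comm a b)) (le_of_not_ge hle)
  rcases hle.eq_or_lt with rfl | hlt
  · simp
  have hd : dist a b = b - a := by rw [dist_comm, Real.dist_eq, abs_of_nonneg (sub_nonneg.2 hle)]
  rw [uIoc_of_le hle, hd]
  exact (dist_sq_le_of_short_scale hr hg (hd ▸ hab hlt.ne)).trans_eq (by ring)

theorem sum_measureReal_uIoc_le {ν : Measure ℝ} [IsLocallyFiniteMeasure ν] {a b : ℝ} {n : ℕ}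
    {I : ℕ → ℝ × ℝ} (hI : (n, I) ∈ AbsolutelyContinuousOnInterval.disjWithin a b) :
    ∑ i ∈ Finset.range n, ν.real (uIoc (I i).1 (I i).2) ≤ ν.real (uIcc a b) := by
  rw [← measureReal_biUnion_finset hI.2 (fun _ _ => measurableSet_uIoc)
    fun i _ => measure_Ioc_lt_top.ne]
  refine measureReal_mono (iUnion₂_subset fun i hi => ?_) isCompact_uIcc.measure_lt_top.ne
  exact (AbsolutelyContinuousOnInterval.uIoc_subset_of_mem_disjWithin hI
    (Finset.mem_range.1 hi)).trans Ioc_subset_Icc_self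

theorem absolutelyContinuousOnInterval_of_short_scale {ν : ℝ → Measure ℝ}
    [∀ r, IsLocallyFiniteMeasure (ν r)] (hC : 0 ≤ C)
    (hg : ∀ r s t, s ≤ t → t - s ≤ r → dist (g s) (g t) ^ 2 ≤ C * (ν r).real (Ioc s t))
    {M a b : ℝ} (hν : ∀ᶠ r in 𝓝[>] 0, (ν r).real (uIcc a b) ≤ M * r) :
    AbsolutelyContinuousOnInterval g a b := by
  have hM : 0 ≤ M := by
    obtain ⟨r, hrM, hr⟩ := (hν.and self_mem_nhdsWithin).exists
    exact nonneg_of_mul_nonneg_left (measureReal_nonneg.trans hrM) hr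
  rw [absolutelyContinuousOnInterval_iff]
  intro ε hε
  refine ⟨ε ^ 2 / (2 * C * M + 1), by positivity, ?_⟩
  rintro ⟨n, I⟩ hI hlen
  dsimp only at hlen ⊢
  have hsmall : ∀ᶠ r in 𝓝[>] (0 : ℝ), ∀ i ∈ Finset.range n, (I i).1 ≠ (I i).2 →
      r ≤ dist (I i).1 (I i).2 := by
    simp only [Filter.eventually_all_finset, eventually_imp_distrib_left]
    intro i _ hne
    filter_upwards [Ioo_mem_nhdsGT (dist_pos.2 hne)] with r hr using hr.2.le
  obtain ⟨r, hrM, hrI, hr⟩ := (hν.and (hsmall.and self_mem_nhdsWithin)).exists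
  replace hr : 0 < r := hr
  refine lt_of_pow_lt_pow_left₀ 2 hε.le ?_
  calc (∑ i ∈ Finset.range n, dist (g (I i).1) (g (I i).2)) ^ 2
      ≤ (∑ i ∈ Finset.range n, dist (I i).1 (I i).2) *
          ∑ i ∈ Finset.range n, 2 * C / r * (ν r).real (uIoc (I i).1 (I i).2) :=
        Finset.sum_sq_le_sum_mul_sum_of_sq_le_mul _ (fun _ _ => dist_nonneg)
          (fun _ _ => by positivity)
          fun i hi => dist_sq_le_mul_uIoc_of_short_scale hr (hg r) (hrI i hi)
    _ ≤ (∑ i ∈ Finset.range n, dist (I i).1 (I i).2) * (2 * C / r * (M * r)) := by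
        rw [← Finset.mul_sum]
        gcongr
        exact (sum_measureReal_uIoc_le hI).trans hrM
    _ = (∑ i ∈ Finset.range n, dist (I i).1 (I i).2) * (2 * C * M) := by field_simp
    _ ≤ (∑ i ∈ Finset.range n, dist (I i).1 (I i).2) * (2 * C * M + 1) := by
        gcongr
        linarith
    _ < ε ^ 2 := by rwa [← lt_div_iff₀ (by positivity)]

end ShortScale

theorem isLocallyFiniteMeasure_map_restrict {X : Type*} [PseudoMetricSpace X] [ProperSpace X]
    [MeasurableSpace X] [OpensMeasurableSpace X] (μ : Measure X) [IsFiniteMeasureOnCompacts μ]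
    {g : X → ℝ} (hg : Measurable g) {s : Set X}
    (hs : ∀ t, Bornology.IsBounded t → Bornology.IsBounded (g ⁻¹' t ∩ s)) :
    IsLocallyFiniteMeasure ((μ.restrict s).map g) := by
  refine ⟨fun x => ⟨Metric.ball x 1, Metric.ball_mem_nhds x one_pos, ?_⟩⟩
  rw [Measure.map_apply hg measurableSet_ball, Measure.restrict_apply (hg measurableSet_ball)]
  exact (hs _ Metric.isBounded_ball).measure_lt_top

/-- The measure on the line which gives a set `S` the mass of the part over `S` of the strip of
half-width `r` around the horizontal line of height `y`. -/
noncomputable def stripMeasure (μ : Measure ℂ) (y r : ℝ) : Measure ℝ :=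
  (μ.restrict (Complex.im ⁻¹' Metric.closedBall y r)).map Complex.re

theorem stripMeasure_apply (μ : Measure ℂ) (y r : ℝ) {s : Set ℝ} (hs : MeasurableSet s) :
    stripMeasure μ y r s = μ (s ×ℂ Metric.closedBall y r) := by
  rw [stripMeasure, Measure.map_apply Complex.measurable_re hs,
    Measure.restrict_apply (Complex.measurable_re hs)]
  rfl

instance (μ : Measure ℂ) [IsFiniteMeasureOnCompacts μ] (y r : ℝ) :
    IsLocallyFiniteMeasure (stripMeasure μ y r) :=
  isLocallyFiniteMeasure_map_restrict μ Complex.measurable_re fun _ ht =>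
    ht.reProdIm Metric.isBounded_closedBall

theorem ae_eventually_measure_closedBall_le (μ ν : Measure ℝ) [IsLocallyFiniteMeasure μ]
    [IsLocallyFiniteMeasure ν] :
    ∀ᵐ x ∂μ, ∃ M : NNReal, ∀ᶠ r in 𝓝[>] 0,
      ν (Metric.closedBall x r) ≤ M * μ (Metric.closedBall x r) := by
  filter_upwards [Besicovitch.ae_tendsto_rnDeriv ν μ, ν.rnDeriv_lt_top μ] with x hx hlt
  obtain ⟨M, hM, -⟩ := ENNReal.lt_iff_exists_nnreal_btwn.1 hlt
  refine ⟨M, ?_⟩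
  filter_upwards [hx.eventually_lt_const hM] with r hr
  exact (ENNReal.div_le_iff_le_mul (.inr ENNReal.coe_ne_top)
    (.inl Metric.isBounded_closedBall.measure_lt_top.ne)).1 hr.le

theorem ae_eventually_stripMeasure_le (μ : Measure ℂ) [IsFiniteMeasureOnCompacts μ] (a b : ℝ) :
    ∀ᵐ y : ℝ, ∃ M : ℝ, ∀ᶠ r in 𝓝[>] 0, (stripMeasure μ y r).real (uIcc a b) ≤ M * r := by
  have : IsLocallyFiniteMeasure ((μ.restrict (Complex.re ⁻¹' uIcc a b)).map Complex.im) :=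
    isLocallyFiniteMeasure_map_restrict μ Complex.measurable_im fun t ht => by
      rw [inter_comm]
      exact (Metric.isBounded_Icc _ _).reProdIm ht
  filter_upwards [ae_eventually_measure_closedBall_le volume
    ((μ.restrict (Complex.re ⁻¹' uIcc a b)).map Complex.im)] with y ⟨M, hM⟩
  refine ⟨2 * M, ?_⟩
  filter_upwards [hM, self_mem_nhdsWithin] with r hr hr0
  rw [Measure.map_apply Complex.measurable_im measurableSet_closedBall,
    Measure.restrict_apply (Complex.measurable_im measurableSet_closedBall), inter_comm] at hr
  rw [Measure.real, stripMeasure_apply _ _ _ measurableSet_uIcc]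
  have hfin : M * volume (Metric.closedBall y r) ≠ ⊤ :=
    ENNReal.mul_ne_top ENNReal.coe_ne_top Metric.isBounded_closedBall.measure_lt_top.ne
  refine (ENNReal.toReal_mono hfin hr).trans_eq ?_
  rw [Real.volume_closedBall, ENNReal.toReal_mul, ENNReal.toReal_ofReal (by simpa using hr0.le),
    ENNReal.coe_toReal]
  ring

theorem WeaklyQuasisymmetric.dist_sq_le_stripMeasure {K : ℝ} {f : ℂ ≃ₜ ℂ}
    (hf : WeaklyQuasisymmetric K f) (y : ℝ) {r s t : ℝ} (hst : s ≤ t) (hr : t - s ≤ r) :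
    dist (f ⟨s, y⟩) (f ⟨t, y⟩) ^ 2 ≤
      4 * K ^ 4 / Real.pi * (stripMeasure (imageArea f) y r).real (Ioc s t) := by
  have hends (x : ℝ) (hx : x ∈ Icc s t) : dist (⟨x, y⟩ : ℂ) ⟨(s + t) / 2, y⟩ ≤ (t - s) / 2 := by
    rw [Complex.dist_of_im_eq (z := ⟨x, y⟩) (w := ⟨(s + t) / 2, y⟩) rfl, Real.dist_eq, abs_le]
    constructor <;> linarith [hx.1, hx.2]
  refine (hf.dist_sq_le_imageArea_ball (hends s (left_mem_Icc.2 hst))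
    (hends t (right_mem_Icc.2 hst))).trans ?_
  gcongr
  rw [Measure.real, Measure.real, stripMeasure_apply _ _ _ measurableSet_Ioc]
  refine ENNReal.toReal_mono ?_ (measure_mono fun w hw => ?_)
  · exact ((Metric.isBounded_Ioc _ _).reProdIm Metric.isBounded_closedBall).measure_lt_top.ne
  rw [Metric.mem_ball, dist_eq_norm] at hw
  have hre := abs_lt.1 ((Complex.abs_re_le_norm _).trans_lt hw)
  have him := (Complex.abs_im_le_norm _).trans_lt hw
  simp only [Complex.sub_re, Complex.sub_im] at hre him
  refine ⟨⟨?_, ?_⟩, ?_⟩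
  · linarith
  · linarith
  · rw [mem_preimage, Metric.mem_closedBall, Real.dist_eq]
    linarith

theorem WeaklyQuasisymmetric.ae_absolutelyContinuousOnInterval {K : ℝ} {f : ℂ ≃ₜ ℂ}
    (hf : WeaklyQuasisymmetric K f) (a b : ℝ) :
    ∀ᵐ y : ℝ, AbsolutelyContinuousOnInterval (fun x : ℝ => f ⟨x, y⟩) a b := by
  filter_upwards [ae_eventually_stripMeasure_le (imageArea f) a b] with y ⟨M, hM⟩
  exact absolutelyContinuousOnInterval_of_short_scale (by positivity)
    (fun r s t => hf.dist_sq_le_stripMeasure y) hM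

theorem ae_complex_iff_ae_ae {s : Set ℂ} (hs : MeasurableSet s) :
    (∀ᵐ z : ℂ, z ∈ s) ↔ ∀ᵐ y : ℝ, ∀ᵐ x : ℝ, (⟨x, y⟩ : ℂ) ∈ s := by
  have hs' : MeasurableSet (Complex.measurableEquivRealProd.symm ⁻¹' s) :=
    Complex.measurableEquivRealProd.symm.measurable hs
  have hswap := Measure.ae_ae_comm (μ := (volume : Measure ℝ)) (ν := (volume : Measure ℝ))
    (p := fun x y => (⟨x, y⟩ : ℂ) ∈ s) hs'
  rw [← hswap, ← Complex.volume_preserving_equiv_real_prod.symm.map_eq,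
    Complex.measurableEquivRealProd.symm.measurableEmbedding.ae_map_iff]
  exact Measure.ae_prod_mem_iff_ae_ae_mem hs'

theorem hasLineDerivAt_one_iff {E : Type*} [NormedAddCommGroup E] [NormedSpace ℝ E] {f : ℂ → E}
    {f' : E} {x y : ℝ} :
    HasLineDerivAt ℝ f f' ⟨x, y⟩ 1 ↔ HasDerivAt (fun x : ℝ => f ⟨x, y⟩) f' x := by
  have h (t : ℝ) : f (⟨x, y⟩ + t • 1) = f ⟨x + t, y⟩ := by
    congr 1
    apply Complex.ext <;> simp
  simp only [HasLineDerivAt, h]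
  refine ⟨fun h => ?_, fun h => .comp_const_add (f := fun x : ℝ => f ⟨x, y⟩) x 0 (by simpa using h)⟩
  simpa using HasDerivAt.comp_sub_const (f := fun t : ℝ => f ⟨x + t, y⟩) x x (by simpa using h)

theorem WeaklyQuasisymmetric.ae_lineDifferentiableAt_one {K : ℝ} {f : ℂ ≃ₜ ℂ}
    (hf : WeaklyQuasisymmetric K f) : ∀ᵐ z, LineDifferentiableAt ℝ f z 1 := by
  refine (ae_complex_iff_ae_ae (measurableSet_lineDifferentiableAt f.continuous)).2 ?_
  filter_upwards [ae_all_iff.2 fun n : ℕ => hf.ae_absolutelyContinuousOnInterval (-n) n] with y hac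
  filter_upwards [ae_all_iff.2 fun n =>
    (hac n).boundedVariationOn.ae_differentiableAt_of_mem_uIcc] with x hx
  obtain ⟨n, hn⟩ := exists_nat_ge |x|
  have hxn : x ∈ uIcc (-n : ℝ) n := Icc_subset_uIcc (abs_le.1 hn)
  exact (hasLineDerivAt_one_iff.2 (hx n hxn).hasDerivAt).lineDifferentiableAt

theorem WeaklyQuasisymmetric.not_ae_lineDeriv_one_eq_zero {K : ℝ} {f : ℂ ≃ₜ ℂ}
    (hf : WeaklyQuasisymmetric K f) : ¬ ∀ᵐ z, lineDeriv ℝ f z 1 = 0 := by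
  intro h
  have hzero : ∀ᵐ z, z ∈ {z | LineDifferentiableAt ℝ f z 1} ∩ (lineDeriv ℝ f · 1) ⁻¹' {0} :=
    hf.ae_lineDifferentiableAt_one.and h
  rw [ae_complex_iff_ae_ae ((measurableSet_lineDifferentiableAt f.continuous).inter
    (measurable_lineDeriv f.continuous (measurableSet_singleton 0)))] at hzero
  obtain ⟨y, hy, hac⟩ := (hzero.and (hf.ae_absolutelyContinuousOnInterval 0 1)).exists
  obtain ⟨C, hC⟩ := hac.const_of_ae_hasDerivAt_zero <| by
    filter_upwards [hy] with x hx _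
    exact hasLineDerivAt_one_iff.1 (hx.2 ▸ hx.1.hasLineDerivAt)
  simpa using f.injective ((hC 0 left_mem_uIcc).trans (hC 1 right_mem_uIcc).symm)

theorem quasiMeasurePreserving_complex_mul_left {v : ℂ} (hv : v ≠ 0) :
    Measure.QuasiMeasurePreserving (fun z => v * z) (volume : Measure ℂ) volume :=
  Measure.LinearMap.quasiMeasurePreserving volume _
    ((LinearEquiv.smulOfNeZero ℂ ℂ v hv).restrictScalars ℝ).isUnit_det'.ne_zero

theorem hasLineDerivAt_comp_mul_left {E : Type*} [NormedAddCommGroup E] [NormedSpace ℝ E]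
    {f : ℂ → E} {c z v : ℂ} {f' : E} :
    HasLineDerivAt ℝ (fun w => f (c * w)) f' z v ↔ HasLineDerivAt ℝ f f' (c * z) (c * v) := by
  simp only [HasLineDerivAt, mul_add, mul_smul_comm]

theorem WeaklyQuasisymmetric.ae_lineDifferentiableAt {K : ℝ} {f : ℂ ≃ₜ ℂ}
    (hf : WeaklyQuasisymmetric K f) (v : ℂ) : ∀ᵐ z, LineDifferentiableAt ℝ f z v := by
  rcases eq_or_ne v 0 with rfl | hv
  · exact Eventually.of_forall fun z => lineDifferentiableAt_zero
  have hone : ∀ᵐ z, LineDifferentiableAt ℝ (fun w => f (v * w)) z 1 :=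
    WeaklyQuasisymmetric.ae_lineDifferentiableAt_one (f := (Homeomorph.mulLeft₀ v hv).trans f)
      (hf.comp_mul_left v)
  filter_upwards [(quasiMeasurePreserving_complex_mul_left (inv_ne_zero hv)).ae hone] with z hz
  have hline := hasLineDerivAt_comp_mul_left.1 hz.hasLineDerivAt
  rw [mul_inv_cancel_left₀ hv, mul_one] at hline
  exact hline.lineDifferentiableAt

theorem WeaklyQuasisymmetric.exists_isAsterisk {K : ℝ} {f : ℂ ≃ₜ ℂ}
    (hf : WeaklyQuasisymmetric K f) : ∃ z, IsAsterisk f z := by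
  have hall : ∀ᵐ z, ∀ a b : ℚ, LineDifferentiableAt ℝ f z ⟨(a : ℝ), (b : ℝ)⟩ :=
    ae_all_iff.2 fun a => ae_all_iff.2 fun b => hf.ae_lineDifferentiableAt _
  obtain ⟨z, hne, hz⟩ :=
    ((not_eventually.1 hf.not_ae_lineDeriv_one_eq_zero).and_eventually hall).exists
  exact ⟨z, hz, hne⟩

section Chord

variable {X : Type*} [PseudoMetricSpace X]

/-- In hyperbolic space, the Euclidean distance between the images of `p` and `q` in the unit ball
model centred at `o`. -/
noncomputable def chord (o p q : X) : ℝ :=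
  Real.sinh (dist p q / 2) / (Real.cosh (dist p o / 2) * Real.cosh (dist q o / 2))

theorem chord_map {Y : Type*} [PseudoMetricSpace Y] {g : X → Y} (hg : Isometry g) (o p q : X) :
    chord (g o) (g p) (g q) = chord o p q := by
  simp only [chord, hg.dist_eq]

theorem chord_nonneg (o p q : X) : 0 ≤ chord o p q :=
  div_nonneg (Real.sinh_nonneg_iff.2 (by positivity)) (by positivity)

theorem chord_le_two (o p q : X) : chord o p q ≤ 2 := by
  rw [chord, div_le_iff₀ (by positivity)]
  have hsinh (x : X) : Real.sinh (dist x o / 2) ≤ Real.cosh (dist x o / 2) :=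
    (Real.sinh_lt_cosh _).le
  calc Real.sinh (dist p q / 2) ≤ Real.sinh (dist p o / 2 + dist q o / 2) :=
        Real.sinh_le_sinh.2 (by linarith [dist_triangle_right p q o])
    _ = Real.sinh (dist p o / 2) * Real.cosh (dist q o / 2) +
          Real.cosh (dist p o / 2) * Real.sinh (dist q o / 2) := Real.sinh_add _ _
    _ ≤ Real.cosh (dist p o / 2) * Real.cosh (dist q o / 2) +
          Real.cosh (dist p o / 2) * Real.cosh (dist q o / 2) := by
        gcongr <;> exact hsinh _
    _ = 2 * (Real.cosh (dist p o / 2) * Real.cosh (dist q o / 2)) := (two_mul _).symm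

theorem cosh_half_dist_le (o o' p : X) :
    Real.cosh (dist p o' / 2) ≤ Real.exp (dist o o' / 2) * Real.cosh (dist p o / 2) := by
  have : 0 ≤ Real.sinh (dist o o' / 2) := Real.sinh_nonneg_iff.2 (by positivity)
  calc Real.cosh (dist p o' / 2) ≤ Real.cosh (dist p o / 2 + dist o o' / 2) := by
        rw [Real.cosh_le_cosh, abs_of_nonneg (by positivity), abs_of_nonneg (by positivity)]
        linarith [dist_triangle p o o']
    _ = Real.cosh (dist p o / 2) * Real.cosh (dist o o' / 2) +
          Real.sinh (dist p o / 2) * Real.sinh (dist o o' / 2) := Real.cosh_add _ _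
    _ ≤ Real.cosh (dist p o / 2) * Real.cosh (dist o o' / 2) +
          Real.cosh (dist p o / 2) * Real.sinh (dist o o' / 2) := by
        gcongr
        exact (Real.sinh_lt_cosh _).le
    _ = Real.exp (dist o o' / 2) * Real.cosh (dist p o / 2) := by
        rw [← Real.cosh_add_sinh]
        ring

theorem chord_le_exp_mul_chord (o o' p q : X) :
    chord o p q ≤ Real.exp (dist o o') * chord o' p q := by
  have hexp : Real.exp (dist o o') = Real.exp (dist o o' / 2) * Real.exp (dist o o' / 2) := by
    rw [← Real.exp_add, add_halves]
  have : 0 ≤ Real.sinh (dist p q / 2) := Real.sinh_nonneg_iff.2 (by positivity)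
  rw [chord, chord, ← mul_div_assoc, div_le_div_iff₀ (by positivity) (by positivity)]
  calc Real.sinh (dist p q / 2) * (Real.cosh (dist p o' / 2) * Real.cosh (dist q o' / 2))
      ≤ Real.sinh (dist p q / 2) * ((Real.exp (dist o o' / 2) * Real.cosh (dist p o / 2)) *
          (Real.exp (dist o o' / 2) * Real.cosh (dist q o / 2))) := by
        gcongr <;> exact cosh_half_dist_le _ _ _
    _ = Real.exp (dist o o') * Real.sinh (dist p q / 2) *
          (Real.cosh (dist p o / 2) * Real.cosh (dist q o / 2)) := by rw [hexp]; ring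

/-- The hyperbolic cross-ratio of four points. It is the cross-ratio of their images in any ball
model, hence extends to ideal points, and is invariant under isometries. -/
noncomputable def sinhCrossRatio (p q r s : X) : ℝ :=
  Real.sinh (dist p q / 2) * Real.sinh (dist r s / 2) /
    (Real.sinh (dist p r / 2) * Real.sinh (dist q s / 2))

theorem sinhCrossRatio_map {Y : Type*} [PseudoMetricSpace Y] {g : X → Y} (hg : Isometry g)
    (p q r s : X) : sinhCrossRatio (g p) (g q) (g r) (g s) = sinhCrossRatio p q r s := by
  simp only [sinhCrossRatio, hg.dist_eq]

theorem sinhCrossRatio_eq_chord (o p q r s : X) :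
    sinhCrossRatio p q r s = chord o p q * chord o r s / (chord o p r * chord o q s) := by
  simp only [sinhCrossRatio, chord]
  have hcosh (x : X) : Real.cosh (dist x o / 2) ≠ 0 := (Real.cosh_pos _).ne'
  have := hcosh p
  have := hcosh q
  have := hcosh r
  have := hcosh s
  field_simp

theorem sinhCrossRatio_le {o p q r s : X} {ε : ℝ} (hε : 0 < ε) (hpr : ε ≤ chord o p r)
    (hqs : ε ≤ chord o q s) : sinhCrossRatio p q r s ≤ 4 / ε ^ 2 := by
  have hrs := chord_nonneg o r s
  have hpr₀ := chord_nonneg o p r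
  rw [sinhCrossRatio_eq_chord o]
  calc chord o p q * chord o r s / (chord o p r * chord o q s) ≤ 2 * 2 / (ε * ε) := by
        gcongr
        · exact chord_le_two o p q
        · exact chord_le_two o r s
    _ = 4 / ε ^ 2 := by ring

end Chord

theorem exists_forall_exists_dist_smul_le (G : Type*) {X : Type*} [Group G] [PseudoMetricSpace X]
    [MulAction G X] [ContinuousConstSMul G X] [CompactSpace (Quotient (MulAction.orbitRel G X))]
    (o : X) : ∃ D : ℝ, ∀ p : X, ∃ g : G, dist (g • p) o ≤ D := by
  have hmk := MulAction.isOpenQuotientMap_quotientMk (Γ := G) (T := X)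
  obtain ⟨n, hn⟩ := isCompact_univ.elim_directed_cover
    (fun n : ℕ => Quotient.mk (MulAction.orbitRel G X) '' Metric.ball o n)
    (fun n => hmk.isOpenMap _ Metric.isOpen_ball)
    (fun x _ => by
      obtain ⟨p, rfl⟩ := hmk.surjective x
      obtain ⟨n, hn⟩ := exists_nat_gt (dist p o)
      exact mem_iUnion.2 ⟨n, p, hn, rfl⟩)
    (Monotone.directed_le fun m n h => image_mono (Metric.ball_subset_ball (by exact_mod_cast h)))
  refine ⟨n, fun p => ?_⟩
  obtain ⟨q, hq, hqp⟩ := hn (mem_univ (Quotient.mk _ p))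
  obtain ⟨g, rfl⟩ := MulAction.orbitRel_apply.1 (Quotient.exact hqp)
  exact ⟨g, (Metric.mem_ball.1 hq).le⟩

theorem exists_pos_forall_le_dist {X Y Z : Type*} [TopologicalSpace X] [CompactSpace X]
    [PseudoMetricSpace Y] [MetricSpace Z] {f : X → Y} {g : X → Z} (hf : Continuous f)
    (hg : Continuous g) (hinj : Function.Injective g) {c : ℝ} (hc : 0 < c) :
    ∃ ε > 0, ∀ x y, c ≤ dist (f x) (f y) → ε ≤ dist (g x) (g y) := by
  have hcompact : IsCompact {x : X × X | c ≤ dist (f x.1) (f x.2)} :=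
    (isClosed_le continuous_const
      ((hf.comp continuous_fst).dist (hf.comp continuous_snd))).isCompact
  have hcont : Continuous fun x : X × X => dist (g x.1) (g x.2) :=
    (hg.comp continuous_fst).dist (hg.comp continuous_snd)
  obtain ⟨ε, hε, h⟩ := hcompact.exists_forall_le' hcont.continuousOn (a := 0) fun x hx =>
    dist_pos.2 <| hinj.ne fun hxy => by
      have hle : c ≤ dist (f x.1) (f x.2) := hx
      rw [hxy, dist_self] at hle
      exact hle.not_gt hc
  exact ⟨ε, hε, fun x y hxy => h (x, y) hxy⟩

namespace H3

/-- The point `(0, 1)`, the centre of the ball model. -/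
def base : H3 := ⟨0, 1, one_pos⟩

theorem chord_eq (o p q : H3) :
    chord o p q = 2 * o.t * dist p.toEuclidean q.toEuclidean /
      (dist p.toEuclidean o.mirror * dist q.toEuclidean o.mirror) := by
  have hp := Real.sqrt_pos.2 p.t_pos
  have hq := Real.sqrt_pos.2 q.t_pos
  have ho := Real.sqrt_pos.2 o.t_pos
  have ho_sq : √o.t * √o.t = o.t := Real.mul_self_sqrt o.t_pos.le
  rw [chord, sinh_half_dist, cosh_half_dist, cosh_half_dist, Real.sqrt_mul p.t_pos.le,
    Real.sqrt_mul p.t_pos.le, Real.sqrt_mul q.t_pos.le]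
  nth_rewrite 3 [← ho_sq]
  field_simp

/-- The isometry of hyperbolic space that extends `w ↦ z + a * w`. -/
noncomputable def affine (z : ℂ) {a : ℂ} (ha : a ≠ 0) (p : H3) : H3 :=
  ⟨z + a * p.z, ‖a‖ * p.t, mul_pos (norm_pos_iff.2 ha) p.t_pos⟩

theorem isometry_affine (z : ℂ) {a : ℂ} (ha : a ≠ 0) : Isometry (affine z ha) := by
  have hnorm := norm_pos_iff.2 ha
  have hdist (p q : H3) : dist (affine z ha p).toEuclidean (affine z ha q).toEuclidean =
      ‖a‖ * dist p.toEuclidean q.toEuclidean := by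
    rw [← sq_eq_sq₀ dist_nonneg (by positivity), mul_pow, euclidean_dist_sq, euclidean_dist_sq]
    simp only [affine, add_sub_add_left_eq_sub, ← mul_sub, norm_mul]
    ring
  refine Isometry.of_dist_eq fun p q => ?_
  have hsqrt : √(‖a‖ * p.t * (‖a‖ * q.t)) = ‖a‖ * √(p.t * q.t) := by
    rw [mul_mul_mul_comm, Real.sqrt_mul (by positivity), Real.sqrt_mul_self hnorm.le]
  rw [dist_eq, dist_eq, hdist]
  simp only [affine, hsqrt]
  rw [mul_left_comm 2, mul_div_mul_left _ _ hnorm.ne']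

/-- The vertical geodesic over `z`, parametrized by arc length. -/
noncomputable def vertical (z : ℂ) (s : ℝ) : H3 := ⟨z, Real.exp s, Real.exp_pos s⟩

end H3

namespace ClosedH3

theorem isInducing_toOnePoint : IsInducing toOnePoint := ⟨rfl⟩

theorem range_toOnePoint : range toOnePoint = ((↑) '' {p : ℂ × ℝ | p.2 < 0})ᶜ := by
  ext x
  constructor
  · rintro ⟨p | (_ | z), rfl⟩ ⟨q, hq, hx⟩
    · obtain rfl := OnePoint.coe_injective hx
      exact p.t_pos.not_gt hq
    · exact OnePoint.coe_ne_infty q hx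
    · obtain rfl := OnePoint.coe_injective hx
      exact lt_irrefl (0 : ℝ) hq
  · intro hx
    induction x using OnePoint.rec with
    | infty => exact ⟨ideal OnePoint.infty, rfl⟩
    | coe p =>
      obtain ⟨z, t⟩ := p
      have ht : 0 ≤ t := not_lt.1 fun ht => hx ⟨_, ht, rfl⟩
      obtain rfl | ht := ht.eq_or_lt
      · exact ⟨ideal z, rfl⟩
      · exact ⟨inner ⟨z, t, ht⟩, rfl⟩

instance : CompactSpace ClosedH3 := by
  rw [← isCompact_univ_iff, isInducing_toOnePoint.isCompact_iff, image_univ, range_toOnePoint]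
  exact (OnePoint.isOpenEmbedding_coe.isOpenMap _
    (isOpen_lt continuous_snd continuous_const)).isClosed_compl.isCompact

theorem tendsto_inner_ideal_coe {ι : Type*} {l : Filter ι} {p : ι → H3} {z : ℂ}
    (hz : Tendsto (fun i => (p i).z) l (𝓝 z)) (ht : Tendsto (fun i => (p i).t) l (𝓝 0)) :
    Tendsto (fun i => inner (p i)) l (𝓝 (ideal z)) :=
  isInducing_toOnePoint.tendsto_nhds_iff.2
    ((OnePoint.continuous_coe.tendsto (z, (0 : ℝ))).comp (hz.prodMk_nhds ht))

theorem tendsto_inner_ideal_infty {ι : Type*} {l : Filter ι} {p : ι → H3}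
    (ht : Tendsto (fun i => (p i).t) l atTop) :
    Tendsto (fun i => inner (p i)) l (𝓝 (ideal OnePoint.infty)) := by
  refine isInducing_toOnePoint.tendsto_nhds_iff.2
    ((OnePoint.tendsto_coe_infty (X := ℂ × ℝ)).comp ?_)
  rw [coclosedCompact_eq_cocompact, ← Metric.cobounded_eq_cocompact,
    ← tendsto_norm_atTop_iff_cobounded]
  exact tendsto_atTop_mono
    (fun i => (le_abs_self _).trans (norm_snd_le ((p i).z, (p i).t))) ht

theorem glue_injective {H : H3 → H3} {h : Sphere → Sphere} (hH : Function.Injective H)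
    (hh : Function.Injective h) : Function.Injective (glue H h) := by
  rintro (p | x) (q | y) hxy
  · rw [hH (inner.inj hxy)]
  · cases hxy
  · cases hxy
  · rw [hh (ideal.inj hxy)]

/-- The map onto the closed unit ball given by the inversion of radius `√2` centred at `(0, -1)`.
The inversion of Mathlib fixes its centre, so that the centre stands for `∞` here. -/
noncomputable def toBall (X : ClosedH3) : WithLp 2 (ℂ × ℝ) :=
  EuclideanGeometry.inversion H3.base.mirror √2
    (X.toOnePoint.elim H3.base.mirror (WithLp.toLp 2))

theorem toBall_inner (p : H3) :
    toBall (inner p) = EuclideanGeometry.inversion H3.base.mirror √2 p.toEuclidean := rfl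

theorem toBall_ideal_coe (z : ℂ) :
    toBall (ideal z) = EuclideanGeometry.inversion H3.base.mirror √2 (WithLp.toLp 2 (z, 0)) := rfl

theorem toBall_ideal_infty : toBall (ideal OnePoint.infty) = H3.base.mirror :=
  EuclideanGeometry.inversion_self _ _

theorem toLp_ne_base_mirror {z : ℂ} {t : ℝ} (ht : 0 ≤ t) :
    WithLp.toLp 2 (z, t) ≠ H3.base.mirror := by
  intro h
  have : t = -1 := congrArg WithLp.snd h
  linarith

theorem dist_toLp_base_mirror (z : ℂ) :
    dist (WithLp.toLp 2 (z, (0 : ℝ))) H3.base.mirror = √(‖z‖ ^ 2 + 1) := by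
  simp [WithLp.prod_dist_eq_of_L2, H3.mirror, H3.base]

theorem dist_toBall_inner (p q : H3) :
    dist (toBall (inner p)) (toBall (inner q)) = chord H3.base p q := by
  rw [toBall_inner, toBall_inner, EuclideanGeometry.dist_inversion_inversion
    (x := p.toEuclidean) (y := q.toEuclidean) (toLp_ne_base_mirror p.t_pos.le)
    (toLp_ne_base_mirror q.t_pos.le), H3.chord_eq,
    Real.sq_sqrt zero_le_two]
  simp only [H3.base]
  ring

theorem dist_toBall_ideal (z w : ℂ) : dist (toBall (ideal z)) (toBall (ideal w)) =
    2 * dist z w / (√(‖z‖ ^ 2 + 1) * √(‖w‖ ^ 2 + 1)) := by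
  have hdist : dist (WithLp.toLp 2 (z, (0 : ℝ))) (WithLp.toLp 2 (w, (0 : ℝ))) = dist z w := by
    simp
  rw [toBall_ideal_coe, toBall_ideal_coe, EuclideanGeometry.dist_inversion_inversion
    (toLp_ne_base_mirror le_rfl) (toLp_ne_base_mirror le_rfl), dist_toLp_base_mirror,
    dist_toLp_base_mirror, Real.sq_sqrt zero_le_two, hdist]
  ring

theorem dist_toBall_ideal_infty (z : ℂ) :
    dist (toBall (ideal z)) (toBall (ideal OnePoint.infty)) = 2 / √(‖z‖ ^ 2 + 1) := by
  rw [toBall_ideal_coe, toBall_ideal_infty, EuclideanGeometry.dist_inversion_center,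
    dist_toLp_base_mirror, Real.sq_sqrt zero_le_two]

theorem toBall_injective : Function.Injective toBall := by
  refine (EuclideanGeometry.inversion_injective _ (by positivity)).comp ?_
  have hinner (p : H3) := toLp_ne_base_mirror (z := p.z) p.t_pos.le
  have hideal (z : ℂ) := toLp_ne_base_mirror (z := z) le_rfl
  rintro (p | (_ | z)) (q | (_ | w)) h
  · obtain ⟨hz, ht⟩ := Prod.ext_iff.1 (WithLp.toLp_injective 2 h)
    rw [H3.ext hz ht]
  · exact absurd h (hinner p)
  · exact absurd (congrArg WithLp.snd h) p.t_pos.ne'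
  · exact absurd h.symm (hinner q)
  · rfl
  · exact absurd h.symm (hideal w)
  · exact absurd (congrArg WithLp.snd h) q.t_pos.ne
  · exact absurd h (hideal z)
  · obtain rfl : z = w := congrArg WithLp.fst h
    rfl

theorem continuous_toBall : Continuous toBall := by
  let F (x : OnePoint (ℂ × ℝ)) : WithLp 2 (ℂ × ℝ) :=
    EuclideanGeometry.inversion H3.base.mirror √2 (x.elim H3.base.mirror (WithLp.toLp 2))
  have hfinite (z : ℂ) {t : ℝ} (ht : 0 ≤ t) : ContinuousAt F ((z, t) : ℂ × ℝ) :=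
    OnePoint.continuousAt_coe.2 (continuousAt_const.inversion continuousAt_const
      (WithLp.prod_continuous_toLp 2 ℂ ℝ).continuousAt (toLp_ne_base_mirror ht))
  have hinfty : ContinuousAt F OnePoint.infty := by
    have hcocompact : Tendsto (WithLp.toLp 2 : ℂ × ℝ → WithLp 2 (ℂ × ℝ)) (cocompact _)
        (cocompact _) := (WithLp.homeomorphProd 2 ℂ ℝ).symm.isClosedEmbedding.tendsto_cocompact
    rw [OnePoint.continuousAt_infty', tendsto_iff_dist_tendsto_zero, coclosedCompact_eq_cocompact]
    simp only [F, Function.comp_def, OnePoint.elim_some, OnePoint.elim_infty,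
      EuclideanGeometry.inversion_self, EuclideanGeometry.dist_inversion_center]
    exact ((tendsto_dist_right_cocompact_atTop H3.base.mirror).comp hcocompact).const_div_atTop _
  refine continuous_iff_continuousAt.2 fun X =>
    ContinuousAt.comp (g := F) ?_ isInducing_toOnePoint.continuous.continuousAt
  obtain p | (_ | z) := X
  · exact hfinite p.z p.t_pos.le
  · exact hinfty
  · exact hfinite z le_rfl

theorem tendsto_chord {ι : Type*} {l : Filter ι} {p q : ι → H3} {X Y : ClosedH3}
    (hp : Tendsto (fun i => inner (p i)) l (𝓝 X)) (hq : Tendsto (fun i => inner (q i)) l (𝓝 Y)) :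
    Tendsto (fun i => chord H3.base (p i) (q i)) l (𝓝 (dist (toBall X) (toBall Y))) := by
  simp only [← dist_toBall_inner]
  exact ((continuous_toBall.tendsto X).comp hp).dist ((continuous_toBall.tendsto Y).comp hq)

theorem tendsto_sinhCrossRatio {ι : Type*} {l : Filter ι} {p q r s : ι → H3} {z w₁ w₂ : ℂ}
    (hne : z ≠ w₂) (hp : Tendsto (fun i => inner (p i)) l (𝓝 (ideal z)))
    (hq : Tendsto (fun i => inner (q i)) l (𝓝 (ideal w₁)))
    (hr : Tendsto (fun i => inner (r i)) l (𝓝 (ideal w₂)))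
    (hs : Tendsto (fun i => inner (s i)) l (𝓝 (ideal OnePoint.infty))) :
    Tendsto (fun i => sinhCrossRatio (p i) (q i) (r i) (s i)) l (𝓝 (dist z w₁ / dist z w₂)) := by
  have hdist : 0 < dist z w₂ := dist_pos.2 hne
  have hlim := ((tendsto_chord hp hq).mul (tendsto_chord hr hs)).div
    ((tendsto_chord hp hr).mul (tendsto_chord hq hs))
    (by
      rw [dist_toBall_ideal, dist_toBall_ideal_infty]
      positivity)
  have hlimit : dist (toBall (ideal z)) (toBall (ideal w₁)) *
      dist (toBall (ideal w₂)) (toBall (ideal OnePoint.infty)) /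
        (dist (toBall (ideal z)) (toBall (ideal w₂)) *
          dist (toBall (ideal w₁)) (toBall (ideal OnePoint.infty))) = dist z w₁ / dist z w₂ := by
    simp only [dist_toBall_ideal, dist_toBall_ideal_infty]
    field_simp
  simp only [sinhCrossRatio_eq_chord H3.base]
  exact hlimit ▸ hlim

theorem tendsto_vertical_atBot (z : ℂ) :
    Tendsto (fun t => inner (H3.vertical z t)) atBot (𝓝 (ideal z)) :=
  tendsto_inner_ideal_coe tendsto_const_nhds Real.tendsto_exp_atBot

theorem tendsto_vertical_atTop (z : ℂ) :
    Tendsto (fun t => inner (H3.vertical z t)) atTop (𝓝 (ideal OnePoint.infty)) :=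
  tendsto_inner_ideal_infty Real.tendsto_exp_atTop

theorem tendsto_affine_vertical_atBot (z w : ℂ) {a : ℂ} (ha : a ≠ 0) :
    Tendsto (fun t => inner (H3.affine z ha (H3.vertical w t))) atBot
      (𝓝 (ideal ((z + a * w : ℂ) : Sphere))) :=
  tendsto_inner_ideal_coe tendsto_const_nhds
    (by simpa only [H3.affine, H3.vertical, mul_zero] using
      Real.tendsto_exp_atBot.const_mul ‖a‖)

theorem tendsto_affine_vertical_atTop (z w : ℂ) {a : ℂ} (ha : a ≠ 0) :
    Tendsto (fun t => inner (H3.affine z ha (H3.vertical w t))) atTop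
      (𝓝 (ideal OnePoint.infty)) :=
  tendsto_inner_ideal_infty (Real.tendsto_exp_atTop.const_mul_atTop (norm_pos_iff.2 ha))

theorem eventually_one_le_chord_vertical {w : ℂ} (hw : ‖w‖ ≤ 1) :
    ∀ᶠ t in atBot, 1 ≤ chord H3.base (H3.vertical 0 t) (H3.vertical 1 t) ∧
      1 ≤ chord H3.base (H3.vertical w t) (H3.vertical 0 (-t)) := by
  have hsqrt : √2 < 2 := Real.sqrt_two_lt_three_halves.trans (by norm_num)
  have hhorizontal : 1 < dist (toBall (ideal (0 : ℂ))) (toBall (ideal (1 : ℂ))) := by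
    rw [dist_toBall_ideal]
    norm_num [Real.lt_sqrt]
  have hvertical : 1 < dist (toBall (ideal w)) (toBall (ideal OnePoint.infty)) := by
    rw [dist_toBall_ideal_infty, one_lt_div (by positivity)]
    exact (Real.sqrt_le_sqrt (by nlinarith [norm_nonneg w])).trans_lt hsqrt
  have hinfty := (tendsto_vertical_atTop 0).comp tendsto_neg_atBot_atTop
  filter_upwards [(tendsto_chord (tendsto_vertical_atBot 0)
      (tendsto_vertical_atBot 1)).eventually_const_lt hhorizontal,
    (tendsto_chord (tendsto_vertical_atBot w) hinfty).eventually_const_lt hvertical]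
    with t h₁ h₂ using ⟨h₁.le, h₂.le⟩

theorem exists_tendsto_ideal_one_le_chord {z w₁ w₂ : ℂ} (hne : w₂ ≠ z)
    (hw : dist w₁ z ≤ dist w₂ z) :
    ∃ (o : H3) (p q r s : ℝ → H3), Tendsto (fun t => inner (p t)) atBot (𝓝 (ideal z)) ∧
      Tendsto (fun t => inner (q t)) atBot (𝓝 (ideal w₁)) ∧
      Tendsto (fun t => inner (r t)) atBot (𝓝 (ideal w₂)) ∧
      Tendsto (fun t => inner (s t)) atBot (𝓝 (ideal OnePoint.infty)) ∧
      ∀ᶠ t in atBot, 1 ≤ chord o (p t) (r t) ∧ 1 ≤ chord o (q t) (s t) := by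
  have ha : w₂ - z ≠ 0 := sub_ne_zero.2 hne
  have hu : ‖(w₁ - z) / (w₂ - z)‖ ≤ 1 := by
    rw [norm_div, ← dist_eq_norm, ← dist_eq_norm]
    exact div_le_one_of_le₀ hw dist_nonneg
  have hlim := fun u => tendsto_affine_vertical_atBot z u ha
  refine ⟨H3.affine z ha H3.base, fun t => H3.affine z ha (H3.vertical 0 t),
    fun t => H3.affine z ha (H3.vertical ((w₁ - z) / (w₂ - z)) t),
    fun t => H3.affine z ha (H3.vertical 1 t), fun t => H3.affine z ha (H3.vertical 0 (-t)),
    ?_, ?_, ?_, (tendsto_affine_vertical_atTop z 0 ha).comp tendsto_neg_atBot_atTop, ?_⟩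
  · simpa using hlim 0
  · simpa [mul_div_cancel₀ _ ha] using hlim ((w₁ - z) / (w₂ - z))
  · simpa using hlim 1
  · simpa only [chord_map (H3.isometry_affine z ha)] using eventually_one_le_chord_vertical hu

end ClosedH3

section BoundaryExtension

open ClosedH3

variable {H : H3 → H3}

theorem exists_sinhCrossRatio_map_le {h : Sphere → Sphere} {Γ : Subgroup (H3 ≃ᵢ H3)}
    (hH : Function.Injective H) (hh : Function.Injective h) (hext : IsBoundaryExtension H h)
    [CompactSpace (Quotient (MulAction.orbitRel Γ H3))]
    (hΓ : ∀ γ ∈ Γ, ∃ γ' : H3 → H3, Isometry γ' ∧ Function.Semiconj H γ γ') :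
    ∃ M, ∀ o p q r s, 1 ≤ chord o p r → 1 ≤ chord o q s →
      sinhCrossRatio (H p) (H q) (H r) (H s) ≤ M := by
  have : ContinuousConstSMul Γ H3 := ⟨fun γ => γ.1.continuous⟩
  obtain ⟨D, hD⟩ := exists_forall_exists_dist_smul_le Γ H3.base
  obtain ⟨ε, hε, hsep⟩ := exists_pos_forall_le_dist continuous_toBall
    (continuous_toBall.comp hext) (toBall_injective.comp (glue_injective hH hh)) (Real.exp_pos (-D))
  refine ⟨4 / ε ^ 2, fun o p q r s hpr hqs => ?_⟩
  obtain ⟨⟨γ, hγ⟩, hγo : dist (γ o) H3.base ≤ D⟩ := hD o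
  obtain ⟨γ', hγ', hcomm⟩ := hΓ γ hγ
  have hchord {x y : H3} (hxy : 1 ≤ chord o x y) : ε ≤ chord H3.base (H (γ x)) (H (γ y)) := by
    have hmoved : Real.exp (-D) ≤ chord H3.base (γ x) (γ y) := by
      rw [Real.exp_neg, inv_le_iff_one_le_mul₀' (Real.exp_pos D)]
      calc 1 ≤ chord (γ o) (γ x) (γ y) := by rwa [chord_map γ.isometry]
        _ ≤ Real.exp (dist (γ o) H3.base) * chord H3.base (γ x) (γ y) :=
            chord_le_exp_mul_chord _ _ _ _
        _ ≤ Real.exp D * chord H3.base (γ x) (γ y) := by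
            gcongr
            exact chord_nonneg _ _ _
    rw [← dist_toBall_inner] at hmoved ⊢
    exact hsep (inner (γ x)) (inner (γ y)) hmoved
  rw [← sinhCrossRatio_map hγ', ← hcomm, ← hcomm, ← hcomm, ← hcomm]
  exact sinhCrossRatio_le hε (hchord hpr) (hchord hqs)

/-- The homeomorphism of the plane given by a homeomorphism of the sphere that fixes `∞`. -/
noncomputable def planeHomeo (h : Sphere ≃ₜ Sphere) (hinf : h OnePoint.infty = OnePoint.infty) :
    ℂ ≃ₜ ℂ where
  toFun := planeMap h hinf
  invFun := planeMap h.symm (h.symm_apply_eq.2 hinf.symm)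
  left_inv z := OnePoint.coe_injective (by simp only [coe_planeMap, h.symm_apply_apply])
  right_inv z := OnePoint.coe_injective (by simp only [coe_planeMap, h.apply_symm_apply])
  continuous_toFun := by
    rw [OnePoint.isOpenEmbedding_coe.isInducing.continuous_iff]
    exact (h.continuous.comp OnePoint.continuous_coe).congr fun z => (coe_planeMap h hinf z).symm
  continuous_invFun := by
    rw [OnePoint.isOpenEmbedding_coe.isInducing.continuous_iff]
    exact (h.symm.continuous.comp OnePoint.continuous_coe).congr fun z =>
      (coe_planeMap h.symm _ z).symm

theorem weaklyQuasisymmetric_planeHomeo {h : Sphere ≃ₜ Sphere} (hext : IsBoundaryExtension H h)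
    (hinf : h OnePoint.infty = OnePoint.infty) {M : ℝ}
    (hM : ∀ o p q r s, 1 ≤ chord o p r → 1 ≤ chord o q s →
      sinhCrossRatio (H p) (H q) (H r) (H s) ≤ M) :
    WeaklyQuasisymmetric M (planeHomeo h hinf) := by
  intro z w₁ w₂ hw
  obtain rfl | hne := eq_or_ne w₂ z
  · obtain rfl : w₁ = w₂ := dist_le_zero.1 (hw.trans_eq (dist_self _))
    simp
  obtain ⟨o, p, q, r, s, hp, hq, hr, hs, hchord⟩ := exists_tendsto_ideal_one_le_chord hne hw
  have hmap {x : ℝ → H3} {y : Sphere} (hx : Tendsto (fun t => inner (x t)) atBot (𝓝 (ideal y))) :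
      Tendsto (fun t => inner (H (x t))) atBot (𝓝 (ideal (h y))) :=
    (hext.tendsto (ideal y)).comp hx
  have hcoe (w : ℂ) : h w = planeHomeo h hinf w := (coe_planeMap h hinf w).symm
  have hne' : planeHomeo h hinf z ≠ planeHomeo h hinf w₂ :=
    (planeHomeo h hinf).injective.ne hne.symm
  have hlim := tendsto_sinhCrossRatio hne' (hcoe z ▸ hmap hp) (hcoe w₁ ▸ hmap hq)
    (hcoe w₂ ▸ hmap hr) (hinf ▸ hmap hs)
  rw [dist_comm _ (planeHomeo h hinf z), dist_comm _ (planeHomeo h hinf z),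
    ← div_le_iff₀ (dist_pos.2 hne')]
  exact le_of_tendsto hlim (hchord.mono fun t ht => hM o _ _ _ _ ht.1 ht.2)

end BoundaryExtension

theorem theorem3_general {H : H3 → H3} {h : Sphere ≃ₜ Sphere} {Γ : Subgroup (H3 ≃ᵢ H3)}
    (hH : Function.Injective H) (hext : IsBoundaryExtension H h)
    [CompactSpace (Quotient (MulAction.orbitRel Γ H3))]
    (hΓ : ∀ γ ∈ Γ, ∃ γ' : H3 → H3, Isometry γ' ∧ Function.Semiconj H γ γ')
    (hinf : h OnePoint.infty = OnePoint.infty) : ∃ z : ℂ, IsAsterisk (planeMap h hinf) z := by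
  obtain ⟨M, hM⟩ := exists_sinhCrossRatio_map_le hH h.injective hext hΓ
  exact (weaklyQuasisymmetric_planeHomeo hext hinf hM).exists_isAsterisk

theorem IsEquivariantPair.exists_semiconj {H : Equiv.Perm H3} {h : Sphere ≃ₜ Sphere}
    (hpair : IsEquivariantPair H h) : ∃ Γ : Subgroup (H3 ≃ᵢ H3),
      CompactSpace (Quotient (MulAction.orbitRel Γ H3)) ∧
      ∀ γ ∈ Γ, ∃ γ' : H3 → H3, Isometry γ' ∧ Function.Semiconj H γ γ' := by
  obtain ⟨Γ₁, Γ₂, hΓ₁, -, hconj, -⟩ := hpair.equivariant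
  refine ⟨Γ₁, hΓ₁.compact, fun γ hγ => ?_⟩
  obtain ⟨γ', -, hγ'⟩ : H * γ.toEquiv * H⁻¹ ∈ IsometryEquiv.toEquiv '' (Γ₂ : Set (H3 ≃ᵢ H3)) :=
    hconj ▸ mem_image_of_mem _ hγ
  refine ⟨γ', γ'.isometry, fun x => ?_⟩
  simpa using (congrArg (fun e : Equiv.Perm H3 => e (H x)) hγ').symm

theorem theorem3 (H : Equiv.Perm H3) (h : Sphere ≃ₜ Sphere) (hpair : IsEquivariantPair H h)
    (hinf : h OnePoint.infty = OnePoint.infty) :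
    ∃ z : ℂ, IsAsterisk (planeMap h hinf) z := by
  obtain ⟨Γ, _, hΓ⟩ := hpair.exists_semiconj
  exact theorem3_general H.injective hpair.ext hΓ hinf
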